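/- Let $d \ge 2$ and $\lambda > 0$. Let $\{x_i : i \ge 1\}$ be a Poisson point process on the orthant $\mathbb{R}_+^d = [0,\infty)^d$ with intensity $\lambda$ (that is, with intensity measure $\lambda$ times Lebesgue measure), and let $\{\rho_i : i \ge 1\}$ be i.i.d. positive random variables, independent of $\{x_i : i \ge 1\}$. Let $$C = \bigcup_{i \ge 1} [x_i(1), x_i(1)+\rho_i] \times \cdots \times [x_i(d), x_i(d)+\rho_i]$$ be the covered region. Say that $\mathbb{R}_+^d$ is eventually covered by $C$ if there exists $0 < t < \infty$ such that $(t,\infty)^d \subseteq C$. (a) If $\liminf_{x\to\infty} x\,P(\rho_1 > x) > 0$ (the value $+\infty$ being allowed), then $P_\lambda(\mathbb{R}_+^d \text{ is eventually covered by } C) = 1$. (b) If $\lim_{x\to\infty} x\,P(\rho_1 > x) = 0$, then $P_\lambda(\mathbb{R}_+^d \text{ is eventually covered by } C) = 0$. -/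

import Mathlib

open MeasureTheory ProbabilityTheory Filter Topology
open scoped NNReal ENNReal

namespace BooleanModel

/-- The number of points of the random sequence `x` (counted with multiplicity) that lie in `B`. -/
noncomputable def pointCount {Ω E : Type*} (x : ℕ → Ω → E) (B : Set E) (ω : Ω) : ℕ∞ :=
  Set.encard {i : ℕ | x i ω ∈ B}

/-- The random points `x 0, x 1, …` enumerate a Poisson point process with intensity measure `Λ`:
the number of points in a measurable set `B` of finite `Λ`-measure has the Poisson law with mean
`Λ B`, and the numbers of points in finitely many disjoint measurable sets are independent. -/
structure IsPoissonProcess {Ω E : Type*} [MeasurableSpace Ω] [MeasurableSpace E]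
    (P : Measure Ω) (Λ : Measure E) (x : ℕ → Ω → E) : Prop where
  measurable_point : ∀ i, Measurable (x i)
  hasLaw_count : ∀ B : Set E, MeasurableSet B → Λ B ≠ ∞ →
    HasLaw (pointCount x B) ((poissonMeasure (Λ B).toNNReal).map (fun n : ℕ => (n : ℕ∞))) P
  indep_count : ∀ (n : ℕ) (B : Fin n → Set E), (∀ j, MeasurableSet (B j)) →
    Pairwise (fun j k => Disjoint (B j) (B k)) → iIndepFun (fun j => pointCount x (B j)) P

/-- The closed orthant `[0, ∞)^d`. -/
def orthant (d : ℕ) : Set (Fin d → ℝ) := {y | ∀ k, 0 ≤ y k}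

/-- The Poisson Boolean model on the orthant `[0, ∞)^d` with random cubes: the points `x i` form a
Poisson process on the orthant whose intensity is `lam` times Lebesgue measure, the side lengths
`ρ i` are i.i.d. and positive, and the sequence `ρ` is independent of the sequence `x`. -/
structure IsPoissonBooleanModel {Ω : Type*} [MeasurableSpace Ω] (P : Measure Ω) (d : ℕ)
    (lam : ℝ≥0) (x : ℕ → Ω → (Fin d → ℝ)) (ρ : ℕ → Ω → ℝ) : Prop where
  poisson : IsPoissonProcess P (lam • (volume : Measure (Fin d → ℝ)).restrict (orthant d)) x
  measurable_side : ∀ i, Measurable (ρ i)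
  pos_side : ∀ i, ∀ᵐ ω ∂P, 0 < ρ i ω
  indep_side : iIndepFun ρ P
  identDistrib_side : ∀ i, IdentDistrib (ρ i) (ρ 0) P P
  indep_point_side : IndepFun (fun ω i => x i ω) (fun ω i => ρ i ω) P

/-- The covered region `C`, the union over `i` of the cubes
`[x_i(1), x_i(1) + ρ_i] × ⋯ × [x_i(d), x_i(d) + ρ_i]`. -/
def coveredRegion {Ω : Type*} {d : ℕ} (x : ℕ → Ω → (Fin d → ℝ)) (ρ : ℕ → Ω → ℝ) (ω : Ω) :
    Set (Fin d → ℝ) :=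
  ⋃ i : ℕ, {y | ∀ k, x i ω k ≤ y k ∧ y k ≤ x i ω k + ρ i ω}

/-- The orthant is eventually covered by `C`: `(t, ∞)^d ⊆ C` for some `0 < t < ∞`. -/
def EventuallyCovered {d : ℕ} (C : Set (Fin d → ℝ)) : Prop :=
  ∃ t : ℝ, 0 < t ∧ {y : Fin d → ℝ | ∀ k, t < y k} ⊆ C

/-- The function `x ↦ x P(ρ > x)`, for `x ≥ 0`, with values in `[0, ∞]`. -/
noncomputable def scaledTail {Ω : Type*} [MeasurableSpace Ω] (P : Measure Ω) (ρ : Ω → ℝ)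
    (x : ℝ) : ℝ≥0∞ :=
  ENNReal.ofReal x * P {ω | x < ρ ω}

end BooleanModel

/-! Everything rests on void probabilities of the marked process: over disjoint bases `B j`, the
chance that no point of `B j` has its mark in `A j` is `∏ exp (-Λ(B j) P(ρ ∈ A j))`. Heavy tail: let
`m` and `M` be the least and greatest coordinates of `n`. Cut a box of width `m` below `n` into `M`
unit slabs along the longest axis. A point at slab distance `i` covers the unit cube at `n` once its
side exceeds `m + 2 + i`. Since `P(ρ > y) ≥ c / y`, the cube is missed with probability at most `((m
+ 2) / (m + 2 + M)) ^ (lam * c * m)`; the factor `m` comes from `m ^ (d - 1) ≥ m`, that is, from `d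
≥ 2`. For large `m` this is `O((M + 1) ^ (-2 * d))`, summable over `n`, and Borel–Cantelli applies.
Light tail: in a strip along one axis, let `U s` be the event that no earlier slab reaches level
`s`. Given `U s`, those slabs cannot reach further levels either, so `U` is a recurrent event. Its
probabilities are bounded below by a multiple of `1 / s`, so their sum diverges and `U s` occurs
infinitely often; each occurrence far out exhibits an uncovered point. -/

namespace BooleanModel

/-! ### Poisson counts and void probabilities of the marked process -/

lemma measurable_pointCount {Ω E : Type*} [MeasurableSpace Ω] [MeasurableSpace E]
    {x : ℕ → Ω → E} (hx : ∀ i, Measurable (x i)) {B : Set E} (hB : MeasurableSet B) :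
    Measurable (pointCount x B) := by
  refine measurable_encard.comp (measurable_set_iff.2 fun i => ?_)
  exact measurableSet_setOfPred.1 (hx i hB)

/-- The probability generating function of the Poisson law. -/
lemma lintegral_pow_poissonMeasure (r : ℝ≥0) {q : ℝ} (hq : 0 ≤ q) :
    ∫⁻ n, ENNReal.ofReal q ^ n ∂(poissonMeasure r) = ENNReal.ofReal (Real.exp (-(r * (1 - q)))) := by
  have hs : HasSum (fun n : ℕ => Real.exp (-r) * (r : ℝ) ^ n / n.factorial * q ^ n)
      (Real.exp (-(r * (1 - q)))) := by
    have h := (NormedSpace.expSeries_div_hasSum_exp ((r : ℝ) * q)).mul_left (Real.exp (-r))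
    rw [← Real.exp_eq_exp_ℝ, ← Real.exp_add] at h
    convert! h using 1
    · ext n; rw [mul_pow]; ring
    · congr 1; ring
  rw [poissonMeasure, lintegral_sum_measure, ← hs.tsum_eq,
    ENNReal.ofReal_tsum_of_nonneg (fun n => by positivity) hs.summable]
  refine tsum_congr fun n => ?_
  rw [lintegral_smul_measure, lintegral_dirac, smul_eq_mul, ← ENNReal.ofReal_pow hq,
    ← ENNReal.ofReal_mul (by positivity)]

lemma IsPoissonProcess.ae_finite {Ω E : Type*} [MeasurableSpace Ω] [MeasurableSpace E]
    {P : Measure Ω} {Λ : Measure E} {x : ℕ → Ω → E} (hx : IsPoissonProcess P Λ x)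
    {B : Set E} (hB : MeasurableSet B) (hΛ : Λ B ≠ ∞) :
    ∀ᵐ ω ∂P, {i : ℕ | x i ω ∈ B}.Finite := by
  have h := (hx.hasLaw_count B hB hΛ).ae_iff (p := fun k => k ≠ ⊤) Measurable.of_discrete
  have h' : ∀ᵐ k ∂((poissonMeasure (Λ B).toNNReal).map (fun n : ℕ => (n : ℕ∞))), k ≠ ⊤ := by
    rw [ae_map_iff Measurable.of_discrete.aemeasurable (MeasurableSet.of_discrete)]
    exact Eventually.of_forall fun n => ENat.natCast_ne_top n
  filter_upwards [h.2 h'] with ω hω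
  exact Set.encard_ne_top_iff.1 hω

lemma IsPoissonProcess.lintegral_pow_count {Ω E : Type*} [MeasurableSpace Ω] [MeasurableSpace E]
    {P : Measure Ω} {Λ : Measure E} {x : ℕ → Ω → E} (hx : IsPoissonProcess P Λ x)
    {B : Set E} (hB : MeasurableSet B) (hΛ : Λ B ≠ ∞) {q : ℝ} (hq : 0 ≤ q) :
    ∫⁻ ω, ENNReal.ofReal q ^ (pointCount x B ω).toNat ∂P
      = ENNReal.ofReal (Real.exp (-((Λ B).toReal * (1 - q)))) := by
  have h := (hx.hasLaw_count B hB hΛ).lintegral_comp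
    (f := fun k : ℕ∞ => ENNReal.ofReal q ^ k.toNat) Measurable.of_discrete.aemeasurable
  refine h.trans ?_
  rw [lintegral_map Measurable.of_discrete Measurable.of_discrete]
  exact lintegral_pow_poissonMeasure (Λ B).toNNReal hq

/-- Probability that none of the marked points falls into a finite union of rectangles
`B j × A j` with disjoint bases `B j`. -/
theorem measure_no_marked_point {Ω E M : Type*} [MeasurableSpace Ω] [MeasurableSpace E]
    [MeasurableSpace M] {P : Measure Ω} [IsProbabilityMeasure P] {Λ : Measure E}
    {x : ℕ → Ω → E} {ρ : ℕ → Ω → M} (hx : IsPoissonProcess P Λ x)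
    (hρ : ∀ i, Measurable (ρ i)) (hind : iIndepFun ρ P)
    (hid : ∀ i, IdentDistrib (ρ i) (ρ 0) P P)
    (hxρ : IndepFun (fun ω i => x i ω) (fun ω i => ρ i ω) P)
    {n : ℕ} {B : Fin n → Set E} {A : Fin n → Set M} (hB : ∀ j, MeasurableSet (B j))
    (hΛ : ∀ j, Λ (B j) ≠ ∞) (hd : Pairwise fun j k => Disjoint (B j) (B k))
    (hA : ∀ j, MeasurableSet (A j)) :
    P {ω | ∀ i j, x i ω ∈ B j → ρ i ω ∉ A j}
      = ∏ j, ENNReal.ofReal (Real.exp (-((Λ (B j)).toReal * P.real (ρ 0 ⁻¹' A j)))) := by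
  have hxm : Measurable fun ω i => x i ω := measurable_pi_lambda _ hx.measurable_point
  have hρm : Measurable fun ω i => ρ i ω := measurable_pi_lambda _ hρ
  set D : Set ((ℕ → E) × (ℕ → M)) := {z | ∀ i j, z.1 i ∈ B j → z.2 i ∉ A j} with hD
  have hDm : MeasurableSet D := by
    rw [hD]
    simp only [Set.ofPred_forall]
    refine MeasurableSet.iInter fun i => MeasurableSet.iInter fun j => ?_
    have h1 : MeasurableSet {z : (ℕ → E) × (ℕ → M) | z.1 i ∈ B j} :=
      ((measurable_pi_apply i).comp measurable_fst) (hB j)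
    have h2 : MeasurableSet {z : (ℕ → E) × (ℕ → M) | z.2 i ∈ A j} :=
      ((measurable_pi_apply i).comp measurable_snd) (hA j)
    exact h1.imp h2.compl
  -- By independence of points and marks, the points can be frozen and only the marks averaged.
  have hstep : P {ω | ∀ i j, x i ω ∈ B j → ρ i ω ∉ A j}
      = ∫⁻ ω, P {ω' | ∀ i j, x i ω ∈ B j → ρ i ω' ∉ A j} ∂P := by
    have h1 : P {ω | ∀ i j, x i ω ∈ B j → ρ i ω ∉ A j}
        = P.map (fun ω => ((fun i => x i ω), fun i => ρ i ω)) D := by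
      rw [Measure.map_apply (hxm.prodMk hρm) hDm]; rfl
    rw [h1, hxρ.map_prod_eq_prod_map_map hxm.aemeasurable hρm.aemeasurable,
      Measure.prod_apply hDm, lintegral_map (measurable_measure_prodMk_left hDm) hxm]
    refine lintegral_congr fun ω => ?_
    rw [Measure.map_apply hρm (measurable_prodMk_left hDm)]
    rfl
  have hfin : ∀ᵐ ω ∂P, ∀ j, {i : ℕ | x i ω ∈ B j}.Finite :=
    ae_all_iff.2 fun j => hx.ae_finite (hB j) (hΛ j)
  set q : Fin n → ℝ := fun j => P.real (ρ 0 ⁻¹' (A j)ᶜ) with hq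
  -- The bases are disjoint, so each index carries at most one constraint and the marks contribute
  -- one factor `q j` per point of `B j`. Averaging over the counts then gives Poisson generating
  -- functions.
  have hcond : ∀ᵐ ω ∂P, P {ω' | ∀ i j, x i ω ∈ B j → ρ i ω' ∉ A j}
      = ∏ j, ENNReal.ofReal (q j) ^ (pointCount x (B j) ω).toNat := by
    filter_upwards [hfin] with ω hω
    classical
    set S : Fin n → Finset ℕ := fun j => (hω j).toFinset with hS
    have hmS : ∀ i j, i ∈ S j ↔ x i ω ∈ B j := fun i j => by simp [hS]
    have hSd : Set.PairwiseDisjoint (↑(Finset.univ : Finset (Fin n))) S := by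
      intro j _ k _ hjk
      refine Finset.disjoint_left.2 fun i hj hk => ?_
      exact Set.disjoint_left.1 (hd hjk) ((hmS i j).1 hj) ((hmS i k).1 hk)
    have hset : {ω' | ∀ i j, x i ω ∈ B j → ρ i ω' ∉ A j}
        = ⋂ i ∈ Finset.univ.biUnion S, ρ i ⁻¹' {a | ∀ j, x i ω ∈ B j → a ∉ A j} := by
      ext ω'
      simp only [Set.mem_ofPred_eq, Set.mem_iInter, Finset.mem_biUnion, Finset.mem_univ, true_and,
        hmS, Set.mem_preimage]
      exact ⟨fun h i _ j hj => h i j hj, fun h i j hj => h i ⟨j, hj⟩ j hj⟩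
    have hmeas : ∀ i, MeasurableSet {a | ∀ j, x i ω ∈ B j → a ∉ A j} := fun i => by
      simp only [Set.ofPred_forall]
      exact MeasurableSet.iInter fun j => MeasurableSet.iInter fun _ => (hA j).compl
    rw [hset, hind.measure_inter_preimage_eq_mul _ (fun i _ => hmeas i), Finset.prod_biUnion hSd]
    refine Finset.prod_congr rfl fun j _ => ?_
    have hcard : (pointCount x (B j) ω).toNat = (S j).card := by
      rw [pointCount, (hω j).encard_eq_coe_toFinset_card]; rfl
    rw [hcard, ← Finset.prod_const]
    refine Finset.prod_congr rfl fun i hi => ?_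
    have hij := (hmS i j).1 hi
    have : {a | ∀ j, x i ω ∈ B j → a ∉ A j} = (A j)ᶜ := by
      ext a
      refine ⟨fun h => h j hij, fun h k hk => ?_⟩
      by_cases hjk : j = k
      · exact hjk ▸ h
      · exact absurd hk (Set.disjoint_left.1 (hd hjk) hij)
    rw [this, (hid i).measure_mem_eq (hA j).compl, hq]
    simp [Measure.real]
  rw [hstep, lintegral_congr_ae hcond]
  have hcount := hx.indep_count n B hB hd
  have hX := hcount.comp (g := fun j (k : ℕ∞) => ENNReal.ofReal (q j) ^ k.toNat)
    (fun j => Measurable.of_discrete)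
  have := lintegral_prod_eq_prod_lintegral_of_indepFun Finset.univ _ hX
    (fun j => Measurable.of_discrete.comp (measurable_pointCount hx.measurable_point (hB j)))
  refine this.trans (Finset.prod_congr rfl fun j _ => ?_)
  refine (hx.lintegral_pow_count (hB j) (hΛ j) measureReal_nonneg).trans ?_
  have : P.real (ρ 0 ⁻¹' (A j)ᶜ) = 1 - P.real (ρ 0 ⁻¹' A j) := by
    rw [Set.preimage_compl, probReal_compl_eq_one_sub (hρ 0 (hA j))]
  rw [this]
  congr 4
  ring

/-! ### Recurrent events -/

/-- A recurrent event in the sense of Feller: after an occurrence at time `s` the process of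
occurrences starts afresh. -/
structure IsRecurrentEvent {Ω : Type*} [MeasurableSpace Ω] (P : Measure Ω) (U : ℕ → Set Ω) :
    Prop where
  measurableSet : ∀ s, MeasurableSet (U s)
  measure_inter : ∀ (s : ℕ) (G : Finset ℕ),
    P.real (U s ∩ ⋂ t ∈ G, U (s + t)) = P.real (U s) * P.real (⋂ t ∈ G, U t)

namespace IsRecurrentEvent

variable {Ω : Type*} [MeasurableSpace Ω] {P : Measure Ω} [IsProbabilityMeasure P] {U : ℕ → Set Ω}

/-- Each complement is removed by `P(V ∩ Aᶜ) = P(V) - P(V ∩ A)`. The removed index joins `G`, hence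
the induction for all `G` at once. -/
lemma measureReal_inter_inter (hU : IsRecurrentEvent P U) (s : ℕ) (F : Finset ℕ) :
    ∀ G : Finset ℕ,
      P.real ((U s ∩ ⋂ t ∈ G, U (s + t)) ∩ ⋂ t ∈ F, (U (s + t))ᶜ)
        = P.real (U s) * P.real ((⋂ t ∈ G, U t) ∩ ⋂ t ∈ F, (U t)ᶜ) := by
  classical
  induction F using Finset.induction_on with
  | empty => intro G; simpa using hU.measure_inter s G
  | insert a F ha ih =>
    intro G
    have key : ∀ (V : Set Ω) (k : ℕ), P.real (V ∩ ⋂ t ∈ insert a F, (U (k + t))ᶜ)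
        = P.real (V ∩ ⋂ t ∈ F, (U (k + t))ᶜ)
          - P.real ((V ∩ U (k + a)) ∩ ⋂ t ∈ F, (U (k + t))ᶜ) := by
      intro V k
      have h := measureReal_inter_add_sdiff (μ := P) (s := V ∩ ⋂ t ∈ F, (U (k + t))ᶜ)
        (hU.measurableSet (k + a))
      have h1 : (V ∩ ⋂ t ∈ F, (U (k + t))ᶜ) ∩ U (k + a)
          = (V ∩ U (k + a)) ∩ ⋂ t ∈ F, (U (k + t))ᶜ := by
        rw [Set.inter_right_comm]
      have h2 : (V ∩ ⋂ t ∈ F, (U (k + t))ᶜ) \ U (k + a)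
          = V ∩ ⋂ t ∈ insert a F, (U (k + t))ᶜ := by
        rw [Finset.set_biInter_insert, Set.sdiff_eq, Set.inter_assoc, Set.inter_comm (⋂ t ∈ F, _)]
      rw [h1, h2] at h
      linarith
    have e1 := key (U s ∩ ⋂ t ∈ G, U (s + t)) s
    have e2 := key (⋂ t ∈ G, U t) 0
    simp only [zero_add] at e2
    have h3 := ih (insert a G)
    rw [Finset.set_biInter_insert, Finset.set_biInter_insert, Set.inter_comm (U (s + a)),
      Set.inter_comm (U a), ← Set.inter_assoc (U s)] at h3
    rw [e1, e2, ih G, h3, mul_sub]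

/-- No occurrence at the times `1, …, N`. -/
def avoids (U : ℕ → Set Ω) (N : ℕ) : Set Ω := ⋂ t ∈ Finset.Icc 1 N, (U t)ᶜ

lemma measureReal_last (hU : IsRecurrentEvent P U) (s N : ℕ) :
    P.real (U s ∩ ⋂ t ∈ Finset.Icc 1 N, (U (s + t))ᶜ) = P.real (U s) * P.real (avoids U N) := by
  simpa [avoids] using hU.measureReal_inter_inter s (Finset.Icc 1 N) ∅

/-- Decomposition at the last occurrence before time `N`. -/
lemma avoids_mul_sum_le (hU : IsRecurrentEvent P U) (N : ℕ) :
    P.real (avoids U N) * ∑ s ∈ Finset.range (N + 1), P.real (U s) ≤ 1 := by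
  -- `W s`, for `s ≤ N`, says that `s` is the last occurrence up to `N`. These events are disjoint,
  -- and `W s` has probability at least `P(U s) P(avoids U N)`.
  set W : ℕ → Set Ω := fun s => U s ∩ ⋂ t ∈ Finset.Icc 1 (N - s), (U (s + t))ᶜ with hW
  have hWm : ∀ s, MeasurableSet (W s) := fun s =>
    (hU.measurableSet s).inter
      (Finset.measurableSet_biInter _ fun t _ => (hU.measurableSet (s + t)).compl)
  have hlt : ∀ s t, s < t → t ≤ N → Disjoint (W s) (W t) := by
    intro s t hst htN
    refine Set.disjoint_left.2 fun ω h1 h2 => ?_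
    have h3 := Set.mem_iInter₂.1 h1.2 (t - s) (Finset.mem_Icc.2 ⟨by omega, by omega⟩)
    rw [Nat.add_sub_cancel' hst.le] at h3
    exact h3 h2.1
  have hdisj : Set.PairwiseDisjoint (↑(Finset.range (N + 1))) W := by
    intro s hs t ht hst
    have hs' : s ≤ N := Nat.lt_succ_iff.1 (Finset.mem_range.1 hs)
    have ht' : t ≤ N := Nat.lt_succ_iff.1 (Finset.mem_range.1 ht)
    rcases lt_or_gt_of_ne hst with h | h
    · exact hlt s t h ht'
    · exact (hlt t s h hs').symm
  calc P.real (avoids U N) * ∑ s ∈ Finset.range (N + 1), P.real (U s)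
      ≤ ∑ s ∈ Finset.range (N + 1), P.real (W s) := by
        rw [Finset.mul_sum]
        refine Finset.sum_le_sum fun s _ => ?_
        rw [hW]
        simp only
        rw [hU.measureReal_last s (N - s), mul_comm]
        refine mul_le_mul_of_nonneg_left (measureReal_mono ?_) measureReal_nonneg
        exact Set.biInter_subset_biInter_left fun t ht => by
          have := Finset.mem_Icc.1 ht
          exact Finset.mem_Icc.2 ⟨this.1, by omega⟩
    _ = P.real (⋃ s ∈ Finset.range (N + 1), W s) :=
        (measureReal_biUnion_finset hdisj fun s _ => hWm s).symm
    _ ≤ 1 := measureReal_le_one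

/-- A recurrent event with divergent sum of probabilities occurs infinitely often. -/
theorem ae_frequently (hU : IsRecurrentEvent P U) (hsum : ¬ Summable fun s => P.real (U s)) :
    ∀ᵐ ω ∂P, ∃ᶠ s in atTop, ω ∈ U s := by
  have hS : Tendsto (fun N => ∑ s ∈ Finset.range (N + 1), P.real (U s)) atTop atTop :=
    ((not_summable_iff_tendsto_nat_atTop_of_nonneg fun s => measureReal_nonneg).1 hsum).comp
      (tendsto_add_atTop_nat 1)
  have hq : Tendsto (fun N => P.real (avoids U N)) atTop (𝓝 0) := by
    refine tendsto_of_tendsto_of_tendsto_of_le_of_le' tendsto_const_nhds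
      (tendsto_inv_atTop_zero.comp hS) (Eventually.of_forall fun N => measureReal_nonneg) ?_
    filter_upwards [hS.eventually_gt_atTop 0] with N hN
    simp only [Function.comp]
    rw [inv_eq_one_div, le_div_iff₀ hN]
    exact hU.avoids_mul_sum_le N
  -- Almost surely no `s` is a last occurrence, since `P(avoids U N)` tends to zero.
  have hzero : ∀ s, ∀ᵐ ω ∂P, ω ∉ U s ∩ ⋂ t ∈ Set.Ici 1, (U (s + t))ᶜ := by
    intro s
    rw [← measure_eq_zero_iff_ae_notMem, ← measureReal_eq_zero_iff]
    refine le_antisymm ?_ measureReal_nonneg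
    refine ge_of_tendsto' hq fun N => ?_
    calc P.real (U s ∩ ⋂ t ∈ Set.Ici 1, (U (s + t))ᶜ)
        ≤ P.real (U s ∩ ⋂ t ∈ Finset.Icc 1 N, (U (s + t))ᶜ) :=
          measureReal_mono (Set.inter_subset_inter_right _
            (Set.biInter_subset_biInter_left fun t ht => (Finset.mem_Icc.1 ht).1))
      _ = P.real (U s) * P.real (avoids U N) := hU.measureReal_last s N
      _ ≤ P.real (avoids U N) := mul_le_of_le_one_left measureReal_nonneg measureReal_le_one
  have hnone : ∀ᵐ ω ∂P, ω ∉ ⋂ t ∈ Set.Ici 1, (U t)ᶜ := by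
    rw [← measure_eq_zero_iff_ae_notMem, ← measureReal_eq_zero_iff]
    refine le_antisymm ?_ measureReal_nonneg
    exact ge_of_tendsto' hq fun N => measureReal_mono
      (Set.biInter_subset_biInter_left fun t ht => (Finset.mem_Icc.1 ht).1)
  filter_upwards [ae_all_iff.2 hzero, hnone] with ω h1 h2
  by_contra hfin
  obtain ⟨a, ha⟩ := eventually_atTop.1 (not_frequently.1 hfin)
  have hbound : ∀ s, ω ∈ U s → s ≤ a := fun s hs => by
    by_contra h; exact ha s (by omega) hs
  classical
  by_cases hne : ∃ s, s ≤ a ∧ ω ∈ U s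
  · obtain ⟨s0, hs0, hs0'⟩ := hne
    have hlast := Nat.findGreatest_spec (P := fun s => ω ∈ U s) hs0 hs0'
    refine h1 (Nat.findGreatest (fun s => ω ∈ U s) a) ⟨hlast, ?_⟩
    simp only [Set.mem_iInter]
    intro t ht hmem
    have := Nat.le_findGreatest (P := fun s => ω ∈ U s) (hbound _ hmem) hmem
    have ht' : 1 ≤ t := ht
    omega
  · refine h2 ?_
    simp only [Set.mem_iInter]
    exact fun t _ hmem => hne ⟨t, hbound t hmem, hmem⟩

end IsRecurrentEvent

/-! ### Void probabilities in the Boolean model -/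

namespace IsPoissonBooleanModel

variable {Ω : Type*} [MeasurableSpace Ω] {P : Measure Ω} [IsProbabilityMeasure P] {d : ℕ}
  {lam : ℝ≥0} {x : ℕ → Ω → (Fin d → ℝ)} {ρ : ℕ → Ω → ℝ}

lemma measurableSet_orthant (d : ℕ) : MeasurableSet (orthant d) := by
  simp only [orthant, Set.ofPred_forall]
  exact MeasurableSet.iInter fun k => measurableSet_le measurable_const (measurable_pi_apply k)

/-- The generating function at `q = 0`, with `0 ^ 0 = 1`, is a void probability. Finiteness of the
count is needed because `toNat` sends `⊤` to `0`. -/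
lemma ae_mem_orthant (h : IsPoissonBooleanModel P d lam x ρ) :
    ∀ᵐ ω ∂P, ∀ i, x i ω ∈ orthant d := by
  have hm := (measurableSet_orthant d).compl
  have h0 : (lam • (volume : Measure (Fin d → ℝ)).restrict (orthant d)) (orthant d)ᶜ = 0 := by
    rw [Measure.smul_apply, Measure.restrict_apply hm]; simp
  have key := h.poisson.lintegral_pow_count hm (by rw [h0]; simp) le_rfl
  have hfin := h.poisson.ae_finite hm (by rw [h0]; simp)
  rw [h0] at key
  simp only [ENNReal.ofReal_zero, ENNReal.toReal_zero, zero_mul, neg_zero, Real.exp_zero,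
    ENNReal.ofReal_one] at key
  have hae : ∀ᵐ ω ∂P, (0 : ℝ≥0∞) ^ (pointCount x (orthant d)ᶜ ω).toNat = 1 := by
    have hle : ∀ ω, (0 : ℝ≥0∞) ^ (pointCount x (orthant d)ᶜ ω).toNat ≤ 1 :=
      fun ω => pow_le_one' zero_le_one _
    have := ae_eq_of_ae_le_of_lintegral_le (μ := P) (g := fun _ => (1 : ℝ≥0∞))
      (Eventually.of_forall hle) (by rw [key]; simp) aemeasurable_const (by simp [key])
    exact this
  filter_upwards [hae, hfin] with ω h1 h2 i
  by_contra hi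
  have hne : (pointCount x (orthant d)ᶜ ω).toNat ≠ 0 := by
    rw [pointCount, h2.encard_eq_coe_toFinset_card]
    exact Finset.card_ne_zero.2 ⟨i, by simpa using hi⟩
  rw [zero_pow hne] at h1
  exact zero_ne_one h1

/-- Void probabilities for finitely many rectangles over disjoint boxes of equal volume. -/
lemma measureReal_no_marked_point (h : IsPoissonBooleanModel P d lam x ρ) {N : ℕ}
    {a b : ℕ → Fin d → ℝ} {A : ℕ → Set ℝ} {v : ℝ} (ha : ∀ j k, 0 ≤ a j k) (hab : ∀ j, a j ≤ b j)
    (hv : ∀ j, ∏ k, (b j k - a j k) = v)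
    (hd : ∀ i j, i ≠ j →
      Disjoint (Set.univ.pi fun k => Set.Ico (a i k) (b i k))
        (Set.univ.pi fun k => Set.Ico (a j k) (b j k)))
    (hA : ∀ j, MeasurableSet (A j)) :
    P.real {ω | ∀ i, ∀ j < N, x i ω ∈ (Set.univ.pi fun k => Set.Ico (a j k) (b j k)) →
        ρ i ω ∉ A j}
      = ∏ j ∈ Finset.range N, Real.exp (-(lam * v * P.real (ρ 0 ⁻¹' A j))) := by
  set B : ℕ → Set (Fin d → ℝ) := fun j => Set.univ.pi fun k => Set.Ico (a j k) (b j k) with hB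
  have hBm : ∀ j, MeasurableSet (B j) := fun j => MeasurableSet.univ_pi fun k => measurableSet_Ico
  have hBo : ∀ j, B j ⊆ orthant d := fun j y hy k => (ha j k).trans (hy k trivial).1
  have hΛ : ∀ j, (lam • (volume : Measure (Fin d → ℝ)).restrict (orthant d)) (B j)
      = ENNReal.ofReal (lam * v) := fun j => by
    rw [Measure.smul_apply, Measure.restrict_apply (hBm j), Set.inter_eq_left.2 (hBo j), hB,
      Real.volume_pi_Ico, ← ENNReal.ofReal_prod_of_nonneg fun k _ => sub_nonneg.2 (hab j k), hv j,
      ENNReal.ofReal_mul lam.coe_nonneg, ENNReal.ofReal_coe_nnreal]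
    rfl
  have hv0 : 0 ≤ v := by
    rw [← hv 0]; exact Finset.prod_nonneg fun k _ => sub_nonneg.2 (hab 0 k)
  have key := measure_no_marked_point h.poisson h.measurable_side h.indep_side
    h.identDistrib_side h.indep_point_side (n := N) (B := fun j => B j) (A := fun j => A j)
    (fun j => hBm j) (fun j => by rw [hΛ]; exact ENNReal.ofReal_ne_top)
    (fun i j hij => hd i j (fun h => hij (Fin.ext h))) (fun j => hA j)
  have hset : {ω | ∀ i, ∀ j < N, x i ω ∈ B j → ρ i ω ∉ A j}
      = {ω | ∀ i, ∀ j : Fin N, x i ω ∈ B j → ρ i ω ∉ A j} := by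
    ext ω
    exact ⟨fun H i j => H i j j.2, fun H i j hj => H i ⟨j, hj⟩⟩
  rw [hset, measureReal_def, key, ENNReal.toReal_prod, ← Fin.prod_univ_eq_prod_range
    (fun j => Real.exp (-(lam * v * P.real (ρ 0 ⁻¹' A j)))) N]
  refine Finset.prod_congr rfl fun j _ => ?_
  rw [ENNReal.toReal_ofReal (Real.exp_pos _).le, hΛ,
    ENNReal.toReal_ofReal (mul_nonneg lam.coe_nonneg hv0)]

end IsPoissonBooleanModel

/-! ### Light tails: no eventual coverage -/

lemma not_summable_prod_exp_neg {p : ℕ → ℝ} {c : ℝ}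
    (hp : Tendsto (fun n : ℕ => (n : ℝ) * p n) atTop (𝓝 0)) :
    ¬ Summable fun s => ∏ i ∈ Finset.range s, Real.exp (-(c * p (i + 1))) := by
  set u : ℕ → ℝ := fun s => ∏ i ∈ Finset.range s, Real.exp (-(c * p (i + 1))) with hu
  have hupos : ∀ s, 0 < u s := fun s => Finset.prod_pos fun i _ => Real.exp_pos _
  have hc : Tendsto (fun n : ℕ => c * ((n : ℝ) * p n)) atTop (𝓝 0) := by
    simpa using hp.const_mul c
  obtain ⟨s0, hs0⟩ := eventually_atTop.1 (hc.eventually (gt_mem_nhds one_pos))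
  -- Once `c * (s + 1) * p (s + 1) < 1`, the bound `exp (-z) ≥ 1 - z` gives `(s + 1) * u (s + 1) ≥ s
  -- * u s`. Thus `u s` dominates a multiple of `1 / s`.
  have hmono : ∀ s, s0 + 1 ≤ s → u (s0 + 1) * ((s0 + 1 : ℕ) : ℝ) ≤ u s * s := by
    intro s hs
    induction s, hs using Nat.le_induction with
    | base => exact le_rfl
    | succ s hs ih =>
      refine ih.trans ?_
      have h1 := hs0 (s + 1) (by omega)
      have h2 := Real.add_one_le_exp (-(c * p (s + 1)))
      have h3 : u (s + 1) = u s * Real.exp (-(c * p (s + 1))) := Finset.prod_range_succ _ _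
      rw [h3, mul_assoc]
      refine mul_le_mul_of_nonneg_left ?_ (hupos s).le
      push_cast at h1 ⊢
      have hs1 : (0 : ℝ) ≤ (s : ℝ) + 1 := by positivity
      nlinarith [mul_le_mul_of_nonneg_right h2 hs1]
  intro hsum
  refine Real.not_summable_one_div_natCast ?_
  have hk : 0 < u (s0 + 1) * ((s0 + 1 : ℕ) : ℝ) := mul_pos (hupos _) (by positivity)
  rw [← summable_nat_add_iff (s0 + 1)]
  refine Summable.of_nonneg_of_le (fun n => by positivity) (fun n => ?_)
    (((summable_nat_add_iff (s0 + 1)).2 hsum).mul_left (u (s0 + 1) * ((s0 + 1 : ℕ) : ℝ))⁻¹)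
  have h := hmono (n + (s0 + 1)) (by omega)
  rw [div_le_iff₀ (by positivity), mul_assoc, inv_mul_eq_div, le_div_iff₀ hk, one_mul]
  exact h

lemma tendsto_natCast_mul_tail {Ω : Type*} [MeasurableSpace Ω] {P : Measure Ω}
    [IsProbabilityMeasure P] {ρ : Ω → ℝ} (h : Tendsto (scaledTail P ρ) atTop (𝓝 0)) :
    Tendsto (fun n : ℕ => (n : ℝ) * P.real (ρ ⁻¹' Set.Ioi ((n : ℝ) - 2))) atTop (𝓝 0) := by
  have h1 : Tendsto (fun n : ℕ => (n : ℝ) - 2) atTop atTop :=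
    tendsto_atTop_add_const_right _ _ tendsto_natCast_atTop_atTop
  -- The factor 3 serves `n ≤ 3 * (n - 2)`, valid for `n ≥ 3`.
  have h2 := ((ENNReal.tendsto_toReal ENNReal.zero_ne_top).comp (h.comp h1)).const_mul 3
  simp only [ENNReal.toReal_zero, mul_zero] at h2
  refine tendsto_of_tendsto_of_tendsto_of_le_of_le' tendsto_const_nhds h2
    (Eventually.of_forall fun n => by positivity) ?_
  filter_upwards [eventually_ge_atTop 3] with n hn
  have hn' : (3 : ℝ) ≤ n := by exact_mod_cast hn
  simp only [Function.comp, scaledTail, ENNReal.toReal_mul]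
  rw [ENNReal.toReal_ofReal (by linarith), ← mul_assoc]
  refine mul_le_mul_of_nonneg_right (by linarith) measureReal_nonneg

namespace IsPoissonBooleanModel

variable {Ω : Type*} [MeasurableSpace Ω] {P : Measure Ω} [IsProbabilityMeasure P] {d : ℕ}
  {lam : ℝ≥0} {x : ℕ → Ω → (Fin d → ℝ)} {ρ : ℕ → Ω → ℝ}

/-- No point of the slabs `B 0, …, B (s - 1)` reaches level `s`, where a point of `B j` with side
length in `A n` reaches level `j + n`. -/
def unreached (x : ℕ → Ω → (Fin d → ℝ)) (ρ : ℕ → Ω → ℝ) (B : ℕ → Set (Fin d → ℝ))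
    (A : ℕ → Set ℝ) (s : ℕ) : Set Ω :=
  {ω | ∀ i, ∀ j < s, x i ω ∈ B j → ρ i ω ∉ A (s - j)}

lemma measureReal_iInter_unreached (h : IsPoissonBooleanModel P d lam x ρ)
    {a b : ℕ → Fin d → ℝ} {A : ℕ → Set ℝ} {v : ℝ} (ha : ∀ j k, 0 ≤ a j k) (hab : ∀ j, a j ≤ b j)
    (hv : ∀ j, ∏ k, (b j k - a j k) = v)
    (hd : ∀ i j, i ≠ j →
      Disjoint (Set.univ.pi fun k => Set.Ico (a i k) (b i k))
        (Set.univ.pi fun k => Set.Ico (a j k) (b j k)))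
    (hA : ∀ j, MeasurableSet (A j)) (G : Finset ℕ) {N : ℕ} (hN : ∀ t ∈ G, t ≤ N) :
    P.real (⋂ t ∈ G, unreached x ρ (fun j => Set.univ.pi fun k => Set.Ico (a j k) (b j k)) A t)
      = ∏ j ∈ Finset.range N, Real.exp (-(lam * v *
          P.real (ρ 0 ⁻¹' ⋃ t ∈ {t | t ∈ G ∧ j < t}, A (t - j)))) := by
  rw [← h.measureReal_no_marked_point ha hab hv hd
    (A := fun j => ⋃ t ∈ {t | t ∈ G ∧ j < t}, A (t - j))
    (fun j => MeasurableSet.biUnion (Set.to_countable _) fun t _ => hA _)]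
  congr 1
  ext ω
  simp only [unreached, Set.mem_iInter, Set.mem_ofPred_eq, Set.mem_iUnion, not_exists]
  constructor
  · intro H i j _ hx t ht
    exact H t ht.1 i j ht.2 hx
  · intro H t ht i j hj hx
    exact H i j (hj.trans_le (hN t ht)) hx t ⟨ht, hj⟩

/-- Slabs before `s` that miss level `s` miss all later levels, because `A` is antitone. Levels
beyond `s` then depend only on the slabs from `s` on, which are independent of the earlier ones and
have the same volume. -/
lemma isRecurrentEvent_unreached (h : IsPoissonBooleanModel P d lam x ρ)
    {a b : ℕ → Fin d → ℝ} {A : ℕ → Set ℝ} {v : ℝ} (ha : ∀ j k, 0 ≤ a j k) (hab : ∀ j, a j ≤ b j)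
    (hv : ∀ j, ∏ k, (b j k - a j k) = v)
    (hd : ∀ i j, i ≠ j →
      Disjoint (Set.univ.pi fun k => Set.Ico (a i k) (b i k))
        (Set.univ.pi fun k => Set.Ico (a j k) (b j k)))
    (hA : ∀ j, MeasurableSet (A j)) (hanti : Antitone A) :
    IsRecurrentEvent P
      (unreached x ρ (fun j => Set.univ.pi fun k => Set.Ico (a j k) (b j k)) A) where
  measurableSet s := by
    simp only [unreached, Set.ofPred_forall]
    refine MeasurableSet.iInter fun i => MeasurableSet.iInter fun j => MeasurableSet.iInter fun _ =>
      MeasurableSet.imp (h.poisson.measurable_point i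
        (MeasurableSet.univ_pi fun k => measurableSet_Ico)) (h.measurable_side i (hA _)).compl
  measure_inter s G := by
    classical
    set U := unreached x ρ (fun j => Set.univ.pi fun k => Set.Ico (a j k) (b j k)) A with hU
    obtain ⟨N, hN⟩ : ∃ N, ∀ t ∈ G, t ≤ N := ⟨G.sup id, fun t ht => Finset.le_sup (f := id) ht⟩
    have hleft : U s ∩ ⋂ t ∈ G, U (s + t) = ⋂ t ∈ insert s (G.image (s + ·)), U t := by
      rw [Finset.set_biInter_insert, Finset.set_biInter_finset_image]
    have hsing : U s = ⋂ t ∈ ({s} : Finset ℕ), U t := by simp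
    rw [hleft, hsing, h.measureReal_iInter_unreached ha hab hv hd hA _ (N := s + N),
      h.measureReal_iInter_unreached ha hab hv hd hA _ (N := s) (by simp),
      h.measureReal_iInter_unreached ha hab hv hd hA _ hN, Finset.prod_range_add]
    · congr 1
      -- Slabs `j < s`: the union of the forbidden mark sets collapses to `A (s - j)`.
      · refine Finset.prod_congr rfl fun j hj => ?_
        have hj := Finset.mem_range.1 hj
        congr 5
        ext y
        simp only [Set.mem_iUnion, Finset.mem_insert, Finset.mem_image, Set.mem_ofPred_eq,
          Finset.mem_singleton, exists_prop]
        constructor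
        · rintro ⟨t, ⟨ht, _⟩, hy⟩
          refine ⟨s, ⟨rfl, hj⟩, hanti (Nat.sub_le_sub_right ?_ j) hy⟩
          rcases ht with rfl | ⟨t', _, rfl⟩ <;> omega
        · rintro ⟨t, ⟨rfl, ht⟩, hy⟩
          exact ⟨t, ⟨Or.inl rfl, ht⟩, hy⟩
      -- Slabs `s + j`: level `s` imposes nothing, and the other constraints are translates of those
      -- for `G`.
      · refine Finset.prod_congr rfl fun j hj => ?_
        congr 5
        ext y
        simp only [Set.mem_iUnion, Finset.mem_insert, Finset.mem_image, Set.mem_ofPred_eq,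
          exists_prop]
        constructor
        · rintro ⟨t, ⟨ht, hlt⟩, hy⟩
          rcases ht with rfl | ⟨t', ht', rfl⟩
          · omega
          · exact ⟨t', ⟨ht', by omega⟩, by rwa [Nat.add_sub_add_left] at hy⟩
        · rintro ⟨t, ⟨ht, hlt⟩, hy⟩
          exact ⟨s + t, ⟨Or.inr ⟨t, ht, rfl⟩, by omega⟩, by rwa [Nat.add_sub_add_left]⟩
    · intro t ht
      rcases Finset.mem_insert.1 ht with rfl | ht
      · omega
      · obtain ⟨t', ht', rfl⟩ := Finset.mem_image.1 ht
        have := hN t' ht'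
        omega

/-- If the side lengths have tail `o(1 / x)`, then infinitely many slabs are left without a point
reaching far. -/
lemma ae_frequently_unreached (h : IsPoissonBooleanModel P d lam x ρ)
    (htail : Tendsto (scaledTail P (ρ 0)) atTop (𝓝 0))
    {a b : ℕ → Fin d → ℝ} {v : ℝ} (ha : ∀ j k, 0 ≤ a j k) (hab : ∀ j, a j ≤ b j)
    (hv : ∀ j, ∏ k, (b j k - a j k) = v)
    (hd : ∀ i j, i ≠ j →
      Disjoint (Set.univ.pi fun k => Set.Ico (a i k) (b i k))
        (Set.univ.pi fun k => Set.Ico (a j k) (b j k))) :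
    ∀ᵐ ω ∂P, ∃ᶠ s in atTop, ω ∈ unreached x ρ
      (fun j => Set.univ.pi fun k => Set.Ico (a j k) (b j k))
      (fun n => Set.Ioi ((n : ℝ) - 2)) s := by
  have hA : ∀ n : ℕ, MeasurableSet (Set.Ioi ((n : ℝ) - 2)) := fun n => measurableSet_Ioi
  have hanti : Antitone fun n : ℕ => Set.Ioi ((n : ℝ) - 2) := fun m n hmn =>
    Set.Ioi_subset_Ioi (by have : (m : ℝ) ≤ n := by exact_mod_cast hmn
                           linarith)
  refine (h.isRecurrentEvent_unreached ha hab hv hd hA hanti).ae_frequently ?_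
  have hu : ∀ s, P.real (unreached x ρ (fun j => Set.univ.pi fun k => Set.Ico (a j k) (b j k))
      (fun n => Set.Ioi ((n : ℝ) - 2)) s) = ∏ i ∈ Finset.range s, Real.exp (-(lam * v *
        P.real (ρ 0 ⁻¹' Set.Ioi (((i + 1 : ℕ) : ℝ) - 2)))) := by
    intro s
    have key := h.measureReal_no_marked_point (N := s) ha hab hv hd
      (A := fun j => Set.Ioi (((s - j : ℕ) : ℝ) - 2)) (fun j => hA _)
    unfold unreached
    rw [key, ← Finset.prod_range_reflect]
    refine Finset.prod_congr rfl fun j hj => ?_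
    have hj := Finset.mem_range.1 hj
    have : s - (s - 1 - j) = j + 1 := by omega
    rw [this]
  rw [funext hu]
  exact not_summable_prod_exp_neg (c := lam * v)
    (p := fun n : ℕ => P.real (ρ 0 ⁻¹' Set.Ioi ((n : ℝ) - 2))) (tendsto_natCast_mul_tail htail)

/-- A light tail of the side lengths leaves uncovered points arbitrarily far from the boundary. -/
theorem ae_not_eventuallyCovered (h : IsPoissonBooleanModel P d lam x ρ) (hd : 0 < d)
    (htail : Tendsto (scaledTail P (ρ 0)) atTop (𝓝 0)) :
    ∀ᵐ ω ∂P, ¬ EventuallyCovered (coveredRegion x ρ ω) := by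
  set k0 : Fin d := ⟨0, hd⟩
  set a : ℕ → Fin d → ℝ := fun j k => if k = k0 then (j : ℝ) else 0 with ha
  -- The strip reaches `T + 2` across, so it contains every point of the orthant whose cube can
  -- cover a point with transverse coordinates `T + 1`.
  set b : ℕ → ℕ → Fin d → ℝ := fun T j k => if k = k0 then (j : ℝ) + 1 else (T : ℝ) + 2 with hb
  have hfreq : ∀ T : ℕ, ∀ᵐ ω ∂P, ∃ᶠ s in atTop, ω ∈ unreached x ρ
      (fun j => Set.univ.pi fun k => Set.Ico (a j k) (b T j k))
      (fun n => Set.Ioi ((n : ℝ) - 2)) s := by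
    intro T
    refine h.ae_frequently_unreached htail (v := ∏ k, if k = k0 then (1 : ℝ) else (T : ℝ) + 2)
      (fun j k => ?_) (fun j k => ?_) (fun j => ?_) (fun i j hij => ?_)
    · simp only [ha]; split_ifs <;> positivity
    · simp only [ha, hb]
      split_ifs
      · linarith
      · positivity
    · refine Finset.prod_congr rfl fun k _ => ?_
      simp only [ha, hb]
      split_ifs <;> ring
    · refine Set.disjoint_left.2 fun y hi hj => hij ?_
      have h1 := hi k0 trivial
      have h2 := hj k0 trivial
      simp only [ha, hb, if_true, Set.mem_Ico] at h1 h2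
      have h3 : (i : ℝ) < (j : ℝ) + 1 := by linarith
      have h4 : (j : ℝ) < (i : ℝ) + 1 := by linarith
      have h3' : i < j + 1 := by exact_mod_cast h3
      have h4' : j < i + 1 := by exact_mod_cast h4
      omega
  filter_upwards [ae_all_iff.2 hfreq, h.ae_mem_orthant] with ω hω horth
  rintro ⟨t, ht, hcov⟩
  obtain ⟨T, hT⟩ := exists_nat_gt t
  obtain ⟨s, hs, hU⟩ := frequently_atTop.1 (hω T) (T + 1)
  have hs' : (T : ℝ) + 1 ≤ s := by exact_mod_cast hs
  -- A cube covering this point starts in some slab `j < s` and has side greater than `s - j - 3 /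
  -- 2`. This is excluded by `A n = Ioi (n - 2)`.
  have hy : (fun k => if k = k0 then (s : ℝ) - 1 / 2 else (T : ℝ) + 1) ∈ coveredRegion x ρ ω := by
    refine hcov fun k => ?_
    split_ifs <;> linarith
  obtain ⟨i, hi⟩ := Set.mem_iUnion.1 hy
  have hi0 := hi k0
  simp only [if_true] at hi0
  have hx0 := horth i k0
  set j := ⌊x i ω k0⌋₊ with hj
  have hj1 := Nat.floor_le hx0
  have hj2 := Nat.lt_floor_add_one (x i ω k0)
  rw [← hj] at hj1 hj2
  have hjs : (j : ℝ) < s := by linarith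
  have hjs' : j < s := by exact_mod_cast hjs
  refine hU i j hjs' (fun k _ => ?_) ?_
  · have hk := hi k
    have hxk := horth i k
    simp only [ha, hb, Set.mem_Ico]
    by_cases hkk : k = k0
    · subst hkk; simp only [if_true]; exact ⟨hj1, hj2⟩
    · simp only [hkk, if_false] at hk ⊢
      exact ⟨hxk, by linarith⟩
  · rw [Set.mem_Ioi, Nat.cast_sub hjs'.le]
    linarith

end IsPoissonBooleanModel

/-! ### Heavy tails: eventual coverage -/

lemma exists_tail_lower_bound {Ω : Type*} [MeasurableSpace Ω] {P : Measure Ω}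
    [IsProbabilityMeasure P] {ρ : Ω → ℝ} (h : 0 < liminf (scaledTail P ρ) atTop) :
    ∃ c : ℝ, 0 < c ∧ ∀ᶠ y in atTop, c / y ≤ P.real (ρ ⁻¹' Set.Ioi y) := by
  -- A finite `c` strictly below the liminf also handles the value `∞`.
  obtain ⟨c, hc0, hc⟩ := ENNReal.lt_iff_exists_nnreal_btwn.1 h
  refine ⟨c, by exact_mod_cast hc0, ?_⟩
  filter_upwards [eventually_lt_of_lt_liminf hc, eventually_gt_atTop 0] with y hy hy0
  rw [div_le_iff₀ hy0, mul_comm]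
  have hne : scaledTail P ρ y ≠ ∞ := ENNReal.mul_ne_top ENNReal.ofReal_ne_top (measure_ne_top _ _)
  have := ENNReal.toReal_mono hne hy.le
  rw [scaledTail, ENNReal.toReal_mul, ENNReal.toReal_ofReal hy0.le] at this
  exact this

lemma log_sub_log_le_sum_inv {y : ℝ} (hy : 0 < y) (M : ℕ) :
    Real.log (y + M) - Real.log y ≤ ∑ i ∈ Finset.range M, 1 / (y + i) := by
  induction M with
  | zero => simp
  | succ M ih =>
    rw [Finset.sum_range_succ]
    have hp : 0 < y + M := by positivity
    have h1 := Real.log_le_sub_one_of_pos (div_pos (by positivity : 0 < y + M + 1) hp)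
    rw [Real.log_div (by positivity) hp.ne', add_div, div_self hp.ne'] at h1
    push_cast
    rw [← add_assoc]
    linarith

lemma summable_prod_inv_sq (d : ℕ) :
    Summable fun n : Fin d → ℕ => ∏ k, (1 / ((n k : ℝ) + 1) ^ 2) := by
  classical
  have hs : Summable fun n : ℕ => 1 / ((n : ℝ) + 1) ^ 2 := by
    have := (summable_nat_add_iff 1).2 (Real.summable_one_div_nat_pow.2 one_lt_two)
    simpa using this
  refine summable_of_sum_le (c := ∏ _k : Fin d, ∑' n : ℕ, 1 / ((n : ℝ) + 1) ^ 2)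
    (fun n => Finset.prod_nonneg fun k _ => by positivity) fun s => ?_
  calc ∑ n ∈ s, ∏ k, (1 / ((n k : ℝ) + 1) ^ 2)
      ≤ ∑ n ∈ Fintype.piFinset fun k => s.image fun n : Fin d → ℕ => n k, ∏ k, (1 / ((n k : ℝ) + 1) ^ 2) := by
        refine Finset.sum_le_sum_of_subset_of_nonneg (fun n hn => ?_)
          fun n _ _ => Finset.prod_nonneg fun k _ => by positivity
        exact Fintype.mem_piFinset.2 fun k => Finset.mem_image_of_mem _ hn
    _ = ∏ k, ∑ j ∈ s.image (fun n : Fin d → ℕ => n k), 1 / ((j : ℝ) + 1) ^ 2 :=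
        (Finset.prod_univ_sum _ fun _ (j : ℕ) => 1 / ((j : ℝ) + 1) ^ 2).symm
    _ ≤ _ := Finset.prod_le_prod (fun k _ => Finset.sum_nonneg fun j _ => by positivity)
        fun k _ => hs.sum_le_tsum _ fun j _ => by positivity

/-- A bound for `((m + 2) / (m + M + 2)) ^ (a * m)` that is polynomially small in `M`, uniformly
in `m ≤ M`. -/
lemma exists_exp_neg_log_le {a : ℝ} (ha : 0 < a) (d : ℕ) :
    ∃ K : ℝ, 0 ≤ K ∧ ∀ m M : ℕ, 1 ≤ m → m ≤ M → d ≤ a * m →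
      Real.exp (-(a * m * (Real.log (m + 2 + M) - Real.log (m + 2)))) ≤ K / ((M : ℝ) + 1) ^ d := by
  set κ : ℝ := Real.log (4 / 3) with hκ
  have hκ0 : 0 < κ := Real.log_pos (by norm_num)
  set γ : ℝ := a * κ with hγ
  have hγ0 : 0 < γ := mul_pos ha hκ0
  -- Split the exponent `a * m` as `d + (a * m - d)`. The first part gives `(m + 2) ^ d / (M + 1) ^
  -- d`; the second gives `exp (-(a * m - d) * κ)`, as `1 ≤ m ≤ M` forces a ratio of at least `4 /
  -- 3`. Bounding `(m + 2) ^ d` by a multiple of `exp (γ * (m + 2))` with `γ = a * κ` cancels `m`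
  -- and leaves `2 * γ + d * κ`.
  refine ⟨d.factorial / γ ^ d * Real.exp (2 * γ + d * κ), by positivity, ?_⟩
  intro m M hm hmM hdm
  have hm' : (1 : ℝ) ≤ m := by exact_mod_cast hm
  have hmM' : (m : ℝ) ≤ M := by exact_mod_cast hmM
  have hm2 : (0 : ℝ) < m + 2 := by positivity
  have hM2 : (0 : ℝ) < m + 2 + M := by positivity
  set X : ℝ := Real.log (m + 2 + M) - Real.log (m + 2) with hX
  have hX' : X = Real.log ((m + 2 + M) / (m + 2)) := by
    rw [Real.log_div hM2.ne' hm2.ne']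
  have hXκ : κ ≤ X := by
    rw [hX', hκ]
    refine Real.log_le_log (by norm_num) ?_
    rw [div_le_div_iff₀ (by norm_num) hm2]
    linarith
  have h1 : Real.exp (-(d * X)) ≤ (m + 2 : ℝ) ^ d / ((M : ℝ) + 1) ^ d := by
    have : Real.exp (-(d * X)) = ((m + 2) / (m + 2 + M)) ^ d := by
      rw [← mul_neg, Real.exp_nat_mul, Real.exp_neg, hX', Real.exp_log (by positivity), inv_div]
    rw [this, ← div_pow]
    exact pow_le_pow_left₀ (by positivity)
      (div_le_div_of_nonneg_left hm2.le (by positivity) (by linarith)) d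
  have h2 : Real.exp (-((a * m - d) * X)) ≤ Real.exp (-((a * m - d) * κ)) :=
    Real.exp_le_exp.2 (neg_le_neg (mul_le_mul_of_nonneg_left hXκ (by linarith)))
  have h3 : (m + 2 : ℝ) ^ d ≤ d.factorial / γ ^ d * Real.exp (γ * (m + 2)) := by
    have := Real.pow_div_factorial_le_exp (γ * (m + 2)) (by positivity) d
    rw [mul_pow, div_le_iff₀ (by positivity)] at this
    rw [div_mul_eq_mul_div, le_div_iff₀ (by positivity)]
    linarith
  calc Real.exp (-(a * m * X))
      = Real.exp (-(d * X)) * Real.exp (-((a * m - d) * X)) := by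
        rw [← Real.exp_add]; congr 1; ring
    _ ≤ ((d.factorial / γ ^ d * Real.exp (γ * (m + 2))) / ((M : ℝ) + 1) ^ d)
          * Real.exp (-((a * m - d) * κ)) := by
        refine mul_le_mul (h1.trans ?_) h2 (Real.exp_pos _).le (by positivity)
        gcongr
    _ = d.factorial / γ ^ d * (Real.exp (γ * (m + 2)) * Real.exp (-((a * m - d) * κ)))
          / ((M : ℝ) + 1) ^ d := by ring
    _ = _ := by
        rw [← Real.exp_add, hγ]
        congr 3
        ring

namespace IsPoissonBooleanModel

variable {Ω : Type*} [MeasurableSpace Ω] {P : Measure Ω} [IsProbabilityMeasure P] {d : ℕ}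
  {lam : ℝ≥0} {x : ℕ → Ω → (Fin d → ℝ)} {ρ : ℕ → Ω → ℝ}

/-- No single cube of the model contains the unit cube with lower corner `n`. -/
def unitCubeMissed (x : ℕ → Ω → (Fin d → ℝ)) (ρ : ℕ → Ω → ℝ) (n : Fin d → ℕ) : Set Ω :=
  {ω | ¬ ∃ i, ∀ k, x i ω k ≤ n k ∧ (n k : ℝ) + 1 ≤ x i ω k + ρ i ω}

/-- Only points below `n` are used: within `m` of it in the directions other than `k0`, and in one
of the unit slabs `j < n k0` along `k0`. Each slab has volume `m ^ (d - 1)`, and its points cover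
the cube once the side exceeds `m + 2 + (n k0 - 1 - j)`. -/
lemma measureReal_unitCubeMissed_le (h : IsPoissonBooleanModel P d lam x ρ) (n : Fin d → ℕ)
    {m : ℕ} (hm : ∀ k, m ≤ n k) (k0 : Fin d) :
    P.real (unitCubeMissed x ρ n) ≤ ∏ i ∈ Finset.range (n k0), Real.exp (-(lam * (m : ℝ) ^ (d - 1) *
      P.real (ρ 0 ⁻¹' Set.Ioi ((m : ℝ) + 2 + i)))) := by
  set a : ℕ → Fin d → ℝ := fun j k => if k = k0 then (j : ℝ) else n k - m with ha
  set b : ℕ → Fin d → ℝ := fun j k => if k = k0 then (j : ℝ) + 1 else n k with hb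
  have hm' : ∀ k, (m : ℝ) ≤ n k := fun k => by exact_mod_cast hm k
  have key := h.measureReal_no_marked_point (N := n k0) (a := a) (b := b)
    (v := (m : ℝ) ^ (d - 1)) (A := fun j => Set.Ioi ((m : ℝ) + 2 + ((n k0 - 1 - j : ℕ) : ℝ)))
    (fun j k => ?_) (fun j k => ?_) (fun j => ?_) (fun i j hij => ?_) (fun j => measurableSet_Ioi)
  · rw [← Finset.prod_range_reflect, ← key]
    refine measureReal_mono fun ω hω i j hj hx hρ => hω ⟨i, fun k => ?_⟩
    have hρ' : (m : ℝ) + 2 + ((n k0 - 1 - j : ℕ) : ℝ) < ρ i ω := hρ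
    have hxk := hx k trivial
    simp only [ha, hb, Set.mem_Ico] at hxk
    have hnn : (0 : ℝ) ≤ ((n k0 - 1 - j : ℕ) : ℝ) := by positivity
    have hj' : ((n k0 - 1 - j : ℕ) : ℝ) = (n k0 : ℝ) - 1 - j := by
      rw [Nat.sub_sub, Nat.cast_sub (by omega)]; push_cast; ring
    by_cases hk : k = k0
    · subst hk
      simp only [if_true] at hxk
      have : (0 : ℝ) ≤ m := by positivity
      constructor <;> linarith
    · simp only [hk, if_false] at hxk
      constructor <;> linarith
  · simp only [ha]
    split_ifs
    · positivity
    · linarith [hm' k]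
  · simp only [ha, hb]
    split_ifs
    · linarith
    · have : (0 : ℝ) ≤ m := by positivity
      linarith
  · have : ∀ k, b j k - a j k = if k = k0 then 1 else (m : ℝ) := fun k => by
      simp only [ha, hb]; split_ifs <;> ring
    simp_rw [this]
    rw [Finset.prod_ite, Finset.prod_const_one, one_mul, Finset.prod_const,
      Finset.filter_ne', Finset.card_erase_of_mem (Finset.mem_univ _), Finset.card_univ,
      Fintype.card_fin]
  · refine Set.disjoint_left.2 fun y hi hj => hij ?_
    have h1 := hi k0 trivial
    have h2 := hj k0 trivial
    simp only [ha, hb, if_true, Set.mem_Ico] at h1 h2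
    have h3 : (i : ℝ) < (j : ℝ) + 1 := by linarith
    have h4 : (j : ℝ) < (i : ℝ) + 1 := by linarith
    have h3' : i < j + 1 := by exact_mod_cast h3
    have h4' : j < i + 1 := by exact_mod_cast h4
    omega

/-- Far from the boundary, the probability that a unit cube is missed is summable. -/
lemma exists_measureReal_unitCubeMissed_le (h : IsPoissonBooleanModel P d lam x ρ) (hd : 2 ≤ d)
    (hlam : 0 < lam) (htail : 0 < liminf (scaledTail P (ρ 0)) atTop) :
    ∃ (N : ℕ) (K : ℝ), ∀ n : Fin d → ℕ, (∀ k, N ≤ n k) →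
      P.real (unitCubeMissed x ρ n) ≤ K * ∏ k, (1 / ((n k : ℝ) + 1) ^ 2) := by
  obtain ⟨c, hc, htail⟩ := exists_tail_lower_bound htail
  obtain ⟨y0, hy0⟩ := eventually_atTop.1 htail
  have ha : 0 < lam * c := mul_pos (by exact_mod_cast hlam) hc
  -- The power `2 * d` allots `(M + 1) ^ (-2) ≤ (n k + 1) ^ (-2)` to each of the `d` coordinates.
  obtain ⟨K, hK, hbound⟩ := exists_exp_neg_log_le ha (2 * d)
  obtain ⟨N1, hN1⟩ := exists_nat_ge y0
  obtain ⟨N2, hN2⟩ := exists_nat_ge ((2 * d : ℕ) / (lam * c))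
  refine ⟨max 1 (max N1 N2), K, fun n hn => ?_⟩
  have : Nonempty (Fin d) := ⟨⟨0, by omega⟩⟩
  obtain ⟨k1, hk1⟩ := Finite.exists_min n
  obtain ⟨k0, hk0⟩ := Finite.exists_max n
  set m := n k1 with hm
  set M := n k0 with hM
  have hmN := hn k1
  rw [← hm] at hmN
  have hm1 : 1 ≤ m := (le_max_left _ _).trans hmN
  have hmN1 : (N1 : ℝ) ≤ m := by
    exact_mod_cast ((le_max_left _ _).trans (le_max_right _ _)).trans hmN
  have hmN2 : (N2 : ℝ) ≤ m := by
    exact_mod_cast ((le_max_right _ _).trans (le_max_right _ _)).trans hmN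
  have hm1' : (1 : ℝ) ≤ m := by exact_mod_cast hm1
  have hdm : ((2 * d : ℕ) : ℝ) ≤ lam * c * m := by
    have := (div_le_iff₀ ha).1 (hN2.trans hmN2)
    linarith
  -- Here `d ≥ 2` enters: the exponent grows with `m`.
  have hpow : (m : ℝ) ≤ (m : ℝ) ^ (d - 1) := le_self_pow₀ hm1' (by omega)
  calc P.real (unitCubeMissed x ρ n)
      ≤ ∏ i ∈ Finset.range M, Real.exp (-(lam * (m : ℝ) ^ (d - 1) *
          P.real (ρ 0 ⁻¹' Set.Ioi ((m : ℝ) + 2 + i)))) :=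
        h.measureReal_unitCubeMissed_le n hk1 k0
    _ ≤ ∏ i ∈ Finset.range M, Real.exp (-(lam * m * (c / ((m : ℝ) + 2 + i)))) := by
        refine Finset.prod_le_prod (fun i _ => (Real.exp_pos _).le) fun i _ => ?_
        refine Real.exp_le_exp.2 (neg_le_neg ?_)
        have hi : (0 : ℝ) ≤ i := by positivity
        have := hy0 ((m : ℝ) + 2 + i) (by linarith)
        gcongr
    _ = Real.exp (-(lam * c * m * ∑ i ∈ Finset.range M, 1 / ((m : ℝ) + 2 + i))) := by
        rw [← Real.exp_sum, Finset.mul_sum, ← Finset.sum_neg_distrib]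
        congr 1
        exact Finset.sum_congr rfl fun i _ => by ring
    _ ≤ Real.exp (-(lam * c * m * (Real.log (m + 2 + M) - Real.log (m + 2)))) := by
        refine Real.exp_le_exp.2 (neg_le_neg ?_)
        exact mul_le_mul_of_nonneg_left (log_sub_log_le_sum_inv (by positivity) M) (by positivity)
    _ ≤ K / ((M : ℝ) + 1) ^ (2 * d) := hbound m M hm1 (hk1 k0) hdm
    _ ≤ K * ∏ k, (1 / ((n k : ℝ) + 1) ^ 2) := by
        rw [div_eq_mul_one_div]
        refine mul_le_mul_of_nonneg_left ?_ hK
        have : 1 / ((M : ℝ) + 1) ^ (2 * d) = ∏ _k : Fin d, 1 / ((M : ℝ) + 1) ^ 2 := by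
          rw [Finset.prod_const, Finset.card_univ, Fintype.card_fin, pow_mul, one_div_pow]
        rw [this]
        refine Finset.prod_le_prod (fun k _ => by positivity) fun k _ => ?_
        have : (n k : ℝ) ≤ M := by exact_mod_cast hk0 k
        gcongr

/-- A heavy tail of the side lengths covers everything far from the boundary. -/
theorem ae_eventuallyCovered (h : IsPoissonBooleanModel P d lam x ρ) (hd : 2 ≤ d)
    (hlam : 0 < lam) (htail : 0 < liminf (scaledTail P (ρ 0)) atTop) :
    ∀ᵐ ω ∂P, EventuallyCovered (coveredRegion x ρ ω) := by
  obtain ⟨N, K, hbound⟩ := h.exists_measureReal_unitCubeMissed_le hd hlam htail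
  -- With the condition `N ≤ n k` inside the event, the terms not covered by the bound vanish.
  have hsum : ∑' n : Fin d → ℕ, P {ω | (∀ k, N ≤ n k) ∧ ω ∈ unitCubeMissed x ρ n} ≠ ∞ := by
    refine ne_top_of_le_ne_top ((summable_prod_inv_sq d).mul_left |K|).tsum_ofReal_ne_top
      (ENNReal.tsum_le_tsum fun n => ?_)
    by_cases hn : ∀ k, N ≤ n k
    · have hset : {ω | (∀ k, N ≤ n k) ∧ ω ∈ unitCubeMissed x ρ n} = unitCubeMissed x ρ n := by
        ext ω
        exact ⟨fun hω => hω.2, fun hω => ⟨hn, hω⟩⟩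
      rw [hset, ← ofReal_measureReal]
      refine ENNReal.ofReal_le_ofReal ((hbound n hn).trans ?_)
      exact mul_le_mul_of_nonneg_right (le_abs_self K)
        (Finset.prod_nonneg fun k _ => by positivity)
    · simp [hn]
  filter_upwards [ae_finite_setOfPred_mem hsum] with ω hω
  obtain ⟨b, hb⟩ := hω.bddAbove
  -- Beyond this threshold the floor `n` of `y` satisfies `n k > N + b k`, so it exceeds the upper
  -- bound `b` of the missed indices.
  refine ⟨(N : ℝ) + 1 + ∑ k, (b k : ℝ), by positivity, fun y hy => ?_⟩
  have hy0 : ∀ k, 0 ≤ y k := fun k => by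
    have : (0 : ℝ) ≤ (N : ℝ) + 1 + ∑ k, (b k : ℝ) := by positivity
    exact this.trans (hy k).le
  set n : Fin d → ℕ := fun k => ⌊y k⌋₊ with hn
  have hlow : ∀ k, (n k : ℝ) ≤ y k := fun k => Nat.floor_le (hy0 k)
  have hupp : ∀ k, y k < n k + 1 := fun k => Nat.lt_floor_add_one (y k)
  have hbig : ∀ k, N + b k < n k := fun k => by
    have h1 : (b k : ℝ) ≤ ∑ k, (b k : ℝ) :=
      Finset.single_le_sum (f := fun k => (b k : ℝ)) (fun k _ => by positivity) (Finset.mem_univ k)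
    have h2 : ((N + b k : ℕ) : ℝ) < n k := by
      push_cast
      linarith [hy k, hupp k]
    exact_mod_cast h2
  have hgood : ω ∉ unitCubeMissed x ρ n := fun hmiss => by
    have hle : n ≤ b := hb ⟨fun k => by have := hbig k; omega, hmiss⟩
    exact absurd (hle ⟨0, by omega⟩) (not_le.2 ((Nat.le_add_left _ _).trans_lt (hbig _)))
  obtain ⟨i, hi⟩ := not_not.1 hgood
  refine Set.mem_iUnion.2 ⟨i, fun k => ?_⟩
  have := hi k
  constructor <;> linarith [hlow k, hupp k]

end IsPoissonBooleanModel

end BooleanModel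

theorem theorem1p4 (d : ℕ) (hd : 2 ≤ d) (lam : ℝ≥0) (hlam : 0 < lam)
    {Ω : Type*} [MeasurableSpace Ω] (P : Measure Ω) [IsProbabilityMeasure P]
    (x : ℕ → Ω → (Fin d → ℝ)) (ρ : ℕ → Ω → ℝ)
    (hmodel : BooleanModel.IsPoissonBooleanModel P d lam x ρ) :
    (0 < liminf (BooleanModel.scaledTail P (ρ 0)) atTop →
      ∀ᵐ ω ∂P, BooleanModel.EventuallyCovered (BooleanModel.coveredRegion x ρ ω)) ∧
    (Tendsto (BooleanModel.scaledTail P (ρ 0)) atTop (𝓝 0) →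
      ∀ᵐ ω ∂P, ¬ BooleanModel.EventuallyCovered (BooleanModel.coveredRegion x ρ ω)) := by
  exact ⟨hmodel.ae_eventuallyCovered hd hlam,
    hmodel.ae_not_eventuallyCovered (by omega)⟩
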